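/- Let $\mathcal X$ be a measurable space of contexts with a probability distribution $\nu$, let $\mathcal A=\{1,\dots,K\}$ be the set of actions, and let $p(\cdot\mid x,a)$ be a cost distribution supported in $[-1,0]$ for every $(x,a)\in\mathcal X\times\mathcal A$ (deterministic costs $c=c(x,a)$ are a special case). For a policy $\pi$, i.e. a probability distribution $\pi(\cdot\mid x)$ on $\mathcal A$ for every $x\in\mathcal X$, let $\mu_\pi$ be the law of $(x,a,c)$ with $x\sim\nu$, $a\sim\pi(\cdot\mid x)$, $c\sim p(\cdot\mid x,a)$, and let $R(\pi)=\mathbb E_{(x,a,c)\sim\mu_\pi}[c]$ be its risk. Let $\pi_0$ be a logging policy. Let $\mathcal H$ be a measurable space of predictors $h:\mathcal X\to\mathcal A$ such that $(h,x)\mapsto h(x)$ is measurable. A probability distribution $\mathbb Q$ on $\mathcal H$ induces the policy $\pi_{\mathbb Q}(a\mid x)=\mathbb E_{h\sim\mathbb Q}[\mathbb I\{h(x)=a\}]$. Let $\lambda>0$, $n\ge 1$, $\delta\in(0,1)$, $\alpha\in[0,1]$, and let $\mathbb P$ be a fixed (prior) probability distribution on $\mathcal H$. Then with probability at least $1-\delta$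 over an i.i.d. sample $\mathcal D_n=(x_i,a_i,c_i)_{i=1}^n\sim\mu_{\pi_0}^n$, the following holds simultaneously for all (posterior) probability distributions $\mathbb Q$ on $\mathcal H$ (which in the case $\alpha=1$ are required to satisfy the overlap condition: $\pi_0(a\mid x)=0$ implies $\pi_{\mathbb Q}(a\mid x)=0$, for all $(x,a)\in\mathcal X\times\mathcal A$): $$|R(\pi_{\mathbb Q})-\hat R_n^\alpha(\pi_{\mathbb Q})|\le\sqrt{\frac{\mathrm{kl}_1(\pi_{\mathbb Q})}{2n}}+B_n^\alpha(\pi_{\mathbb Q})+\frac{\mathrm{kl}_2(\pi_{\mathbb Q})}{n\lambda}+\frac{\lambda}{2}\bar V_n^\alpha(\pi_{\mathbb Q}),$$ where $$\hat R_n^\alpha(\pi)=\frac1n\sum_{i=1}^n c_i\,\frac{\pi(a_i\mid x_i)}{\pi_0(a_i\mid x_i)^\alpha},\qquad B_n^\alpha(\pi)=1-\frac1n\sum_{i=1}^n\mathbb E_{a\sim\pi(\cdot\mid x_i)}\big[\pi_0(a\mid x_i)^{1-\alpha}\big],$$ $$\bar V_n^\alpha(\pi)=\frac1n\sum_{i=1}^n\left(\mathbb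 E_{a\sim\pi_0(\cdot\mid x_i)}\Big[\frac{\pi(a\mid x_i)}{\pi_0(a\mid x_i)^{2\alpha}}\Big]+\frac{\pi(a_i\mid x_i)\,c_i^2}{\pi_0(a_i\mid x_i)^{2\alpha}}\right),$$ $$\mathrm{kl}_1(\pi_{\mathbb Q})=D_{\mathrm{KL}}(\mathbb Q\,\|\,\mathbb P)+\ln\frac{4\sqrt n}{\delta},\qquad \mathrm{kl}_2(\pi_{\mathbb Q})=D_{\mathrm{KL}}(\mathbb Q\,\|\,\mathbb P)+\ln\frac4\delta.$$ (The inequality is trivial when $D_{\mathrm{KL}}(\mathbb Q\,\|\,\mathbb P)=+\infty$.) No boundedness of the importance weights $\pi_{\mathbb Q}/\pi_0$ is assumed; $\alpha=1$ is standard inverse propensity scoring. -/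

import Mathlib

open MeasureTheory ProbabilityTheory

namespace OffPolicy

noncomputable section

/-- The joint law `μ_π` of `(x, a, c)`: the context is drawn from `ν`, the action from the policy
`π(· | x)` and the cost from `p(· | x, a)`. -/
def jointLaw {X : Type*} [MeasurableSpace X] {K : ℕ} (ν : Measure X)
    (π : Kernel X (Fin K)) (p : Kernel (X × Fin K) ℝ) : Measure (X × Fin K × ℝ) :=
  ν ⊗ₘ (π ⊗ₖ p)

/-- The probability `π(a | x)` that the policy `π` takes action `a` in context `x`. -/
def prob {X : Type*} [MeasurableSpace X] {K : ℕ} (π : Kernel X (Fin K)) (a : Fin K) (x : X) : ℝ :=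
  (π x).real {a}

/-- The policy `π_Q` induced by a distribution `Q` on a (jointly measurable) family of
predictors `pred h : X → Fin K`, `h : H`: in context `x`, draw `h` from `Q` and play `pred h x`. -/
def inducedPolicy {X H : Type*} [MeasurableSpace X] [MeasurableSpace H] {K : ℕ}
    (pred : H → X → Fin K) (hpred : Measurable (Function.uncurry pred))
    (Q : Measure H) [SFinite Q] : Kernel X (Fin K) where
  toFun x := Q.map (fun h => pred h x)
  measurable' := by
    refine Measure.measurable_of_measurable_coe _ fun s hs => ?_
    have hx : ∀ x : X, Measurable (fun h => pred h x) := fun x =>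
      hpred.comp (measurable_id.prodMk measurable_const)
    simp_rw [Measure.map_apply (hx _) hs]
    exact measurable_measure_prodMk_left ((hpred.comp measurable_swap) hs)

/-- `π_Q(a | x) = E_{h ∼ Q}[1{h(x) = a}]`. -/
theorem prob_inducedPolicy {X H : Type*} [MeasurableSpace X] [MeasurableSpace H] {K : ℕ}
    (pred : H → X → Fin K) (hpred : Measurable (Function.uncurry pred))
    (Q : Measure H) [SFinite Q] (a : Fin K) (x : X) :
    prob (inducedPolicy pred hpred Q) a x = ∫ h, (if pred h x = a then 1 else 0 : ℝ) ∂Q := by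
  have hx : Measurable (fun h => pred h x) := hpred.comp (measurable_id.prodMk measurable_const)
  have hs : MeasurableSet {h | pred h x = a} := hx (measurableSet_singleton a)
  have h1 : prob (inducedPolicy pred hpred Q) a x = Q.real {h | pred h x = a} := by
    change (Q.map (fun h => pred h x)).real {a} = _
    rw [map_measureReal_apply hx (measurableSet_singleton a)]
    rfl
  rw [h1, ← integral_indicator_one hs]
  refine integral_congr_ae (Filter.Eventually.of_forall fun h => ?_)
  simp [Set.indicator_apply]

/-- The risk `R(π) = E_{(x, a, c) ∼ μ_π}[c]`. -/
def risk {X : Type*} [MeasurableSpace X] {K : ℕ} (ν : Measure X)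
    (p : Kernel (X × Fin K) ℝ) (π : Kernel X (Fin K)) : ℝ :=
  ∫ z, z.2.2 ∂(jointLaw ν π p)

/-- The exponentially smoothed estimator
`(1/n) ∑ i, c_i π(a_i | x_i) / π₀(a_i | x_i) ^ α` on the data `D i = (x_i, a_i, c_i)`. -/
def estimator {X : Type*} [MeasurableSpace X] {K n : ℕ} (π₀ : Kernel X (Fin K)) (α : ℝ)
    (D : Fin n → X × Fin K × ℝ) (π : Kernel X (Fin K)) : ℝ :=
  (1 / (n : ℝ)) * ∑ i, (D i).2.2 *
    (prob π (D i).2.1 (D i).1 / prob π₀ (D i).2.1 (D i).1 ^ α)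

/-- The empirical bias `1 - (1/n) ∑ i, E_{a ∼ π(· | x_i)}[π₀(a | x_i) ^ (1 - α)]`. -/
def empiricalBias {X : Type*} [MeasurableSpace X] {K n : ℕ} (π₀ : Kernel X (Fin K)) (α : ℝ)
    (D : Fin n → X × Fin K × ℝ) (π : Kernel X (Fin K)) : ℝ :=
  1 - (1 / (n : ℝ)) * ∑ i, ∫ a, prob π₀ a (D i).1 ^ (1 - α) ∂(π (D i).1)

/-- The second-moment term
`(1/n) ∑ i, (E_{a ∼ π₀(· | x_i)}[π(a | x_i) / π₀(a | x_i) ^ (2α)]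
  + π(a_i | x_i) c_i ^ 2 / π₀(a_i | x_i) ^ (2α))`. -/
def secondMoment {X : Type*} [MeasurableSpace X] {K n : ℕ} (π₀ : Kernel X (Fin K)) (α : ℝ)
    (D : Fin n → X × Fin K × ℝ) (π : Kernel X (Fin K)) : ℝ :=
  (1 / (n : ℝ)) * ∑ i,
    ((∫ a, prob π a (D i).1 / prob π₀ a (D i).1 ^ (2 * α) ∂(π₀ (D i).1)) +
      prob π (D i).2.1 (D i).1 * (D i).2.2 ^ 2 / prob π₀ (D i).2.1 (D i).1 ^ (2 * α))

/-- `KL(Q ‖ P) + ln (4 √n / δ)`, for finite `KL(Q ‖ P)`. -/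
def kl₁ {H : Type*} [MeasurableSpace H] (n : ℕ) (δ : ℝ) (P Q : Measure H) : ℝ :=
  (InformationTheory.klDiv Q P).toReal + Real.log (4 * Real.sqrt n / δ)

/-- `KL(Q ‖ P) + ln (4 / δ)`, for finite `KL(Q ‖ P)`. -/
def kl₂ {H : Type*} [MeasurableSpace H] (δ : ℝ) (P Q : Measure H) : ℝ :=
  (InformationTheory.klDiv Q P).toReal + Real.log (4 / δ)

end

end OffPolicy

/-!
Write `q b = π_Q(b | x)`, `w b = π₀(b | x)` and `c̄ b` for the mean cost of action `b` in context
`x`. Two averages over the observed contexts are inserted between `R(π_Q)` and the estimator: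
`A = (1/n) ∑ i, ∑ b, q b * c̄ b`, the average risk, and
`S = (1/n) ∑ i, ∑ b, q b * w b / w b ^ α * c̄ b`, the conditional mean of the estimator given the
contexts. The three differences are bounded separately.

* `|R - A|`: for one predictor this is the deviation of an empirical mean of variables in an
  interval of length one, and `exp (2 n Δ ^ 2)` has expectation at most `2 √n`
  (`lintegral_exp_sq_deviation_le`). The quadratic exponent is dominated by an integral of the
  linear exponents `4 n Δ u - 2 n u ^ 2` over `u` in the unit interval that contains `Δ`, and
  Hoeffding's lemma bounds the expectation of each of those by one.
* `|A - S|`: as costs lie in `[-1, 0]`, this is at most the empirical bias, deterministically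
  (`abs_smoothing_bias_le`). For `α = 1` an action with `w b = 0` contributes to `A` but neither to
  `S` nor to the bias term, and the overlap condition excludes it.
* `|S - T|` for the estimator `T`: the inequality `exp (x - x ^ 2 / 2) ≤ 1 + x + x ^ 2 / 2` gives an
  exponential moment at most one for the deviation penalised by its own squares
  (`lintegral_exp_self_normalized_le_one`). It is applied conditionally on the context, where the
  importance weight takes finitely many values, so no uniform bound on the weights is needed.

Both exponential moments hold for a fixed predictor. The Donsker-Varadhan inequality and Markov's
inequality for the prior-averaged exponential (`exists_pacBayes_event`) make them uniform over
posteriors. The failure probabilities are `δ / 2` for the first difference and `δ / 4` for each sign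
of the third.
-/

namespace OffPolicy

/-! ### Analytic inequalities -/

theorem exp_sub_sq_div_two_le (x : ℝ) : Real.exp (x - x ^ 2 / 2) ≤ 1 + x + x ^ 2 / 2 := by
  set g : ℝ → ℝ := fun y => (1 + y + y ^ 2 / 2) * Real.exp (y ^ 2 / 2 - y) with hg
  have hd (y : ℝ) :
      HasDerivAt g (y * (1 + y / 2 + y ^ 2 / 2) * Real.exp (y ^ 2 / 2 - y)) y := by
    have h1 : HasDerivAt (fun y : ℝ => 1 + y + y ^ 2 / 2) (1 + y) y := by
      have := ((hasDerivAt_id' y).const_add 1).add ((hasDerivAt_pow 2 y).div_const 2)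
      exact this.congr_deriv (by simp)
    have h2 : HasDerivAt (fun y : ℝ => y ^ 2 / 2 - y) (y - 1) y := by
      have := ((hasDerivAt_pow 2 y).div_const 2).sub (hasDerivAt_id' y)
      exact this.congr_deriv (by simp)
    exact (h1.mul h2.exp).congr_deriv (by ring)
  have hc : Continuous g := continuous_iff_continuousAt.2 fun y => (hd y).continuousAt
  have hpos (y : ℝ) : 0 ≤ 1 + y / 2 + y ^ 2 / 2 := by nlinarith [sq_nonneg (y + 1 / 2)]
  have hg1 : 1 ≤ g x := by
    have h0 : g 0 = 1 := by simp [hg]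
    rw [← h0]
    rcases le_total 0 x with hx | hx
    · refine monotoneOn_of_deriv_nonneg (convex_Ici 0) hc.continuousOn
        (fun y _ => (hd y).differentiableAt.differentiableWithinAt) (fun y hy => ?_)
        Set.self_mem_Ici hx hx
      rw [interior_Ici] at hy
      rw [(hd y).deriv]
      exact mul_nonneg (mul_nonneg (le_of_lt hy) (hpos y)) (Real.exp_pos _).le
    · refine antitoneOn_of_deriv_nonpos (convex_Iic 0) hc.continuousOn
        (fun y _ => (hd y).differentiableAt.differentiableWithinAt) (fun y hy => ?_)
        hx Set.self_mem_Iic hx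
      rw [interior_Iic] at hy
      rw [(hd y).deriv]
      exact mul_nonpos_of_nonpos_of_nonneg
        (mul_nonpos_of_nonpos_of_nonneg (le_of_lt hy) (hpos y)) (Real.exp_pos _).le
  calc Real.exp (x - x ^ 2 / 2)
      ≤ Real.exp (x - x ^ 2 / 2) * g x := le_mul_of_one_le_right (Real.exp_pos _).le hg1
    _ = (1 + x + x ^ 2 / 2) * (Real.exp (x - x ^ 2 / 2) * Real.exp (x ^ 2 / 2 - x)) := by
        rw [hg]; ring
    _ = 1 + x + x ^ 2 / 2 := by rw [← Real.exp_add]; simp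

/-- On `[0, 1/√n]` the integrand is at least `(1 - n w ^ 2) ^ 2`, whose integral is
`8 / (15 √n)`. -/
theorem half_inv_sqrt_le_integral_exp {n : ℝ} (hn : 1 ≤ n) :
    1 / (2 * √n) ≤ ∫ w in (0 : ℝ)..1, Real.exp (-(2 * n * w ^ 2)) := by
  have hs : 1 ≤ √n := Real.one_le_sqrt.2 hn
  have hs0 : 0 < √n := by linarith
  set r : ℝ := (√n)⁻¹ with hr
  have hr0 : 0 < r := inv_pos.2 hs0
  have hr1 : r ≤ 1 := inv_le_one_of_one_le₀ hs
  have hnr : n * r ^ 2 = 1 := by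
    rw [hr, inv_pow, Real.sq_sqrt (by linarith), mul_inv_cancel₀ (by linarith)]
  have hcont : Continuous fun w : ℝ => Real.exp (-(2 * n * w ^ 2)) := by fun_prop
  calc 1 / (2 * √n) ≤ r - 2 * n * (r ^ 3 / 3) + n ^ 2 * (r ^ 5 / 5) := by
        have h1 : 2 * n * (r ^ 3 / 3) = 2 / 3 * r := by
          calc _ = 2 / 3 * r * (n * r ^ 2) := by ring
            _ = _ := by rw [hnr, mul_one]
        have h2 : n ^ 2 * (r ^ 5 / 5) = 1 / 5 * r := by
          calc _ = 1 / 5 * r * (n * r ^ 2) ^ 2 := by ring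
            _ = _ := by rw [hnr]; ring
        have h3 : 1 / (2 * √n) = 1 / 2 * r := by rw [hr, one_div, mul_inv]; ring
        rw [h1, h2, h3]
        linarith
    _ = ∫ w in (0 : ℝ)..r, (1 - n * w ^ 2) ^ 2 := by
        have h (w : ℝ) : (1 - n * w ^ 2) ^ 2 = 1 - 2 * n * w ^ 2 + n ^ 2 * w ^ 4 := by ring
        simp_rw [h]
        rw [intervalIntegral.integral_add, intervalIntegral.integral_sub]
        · simp only [intervalIntegral.integral_const_mul, integral_pow]
          norm_num
        all_goals exact Continuous.intervalIntegrable (by fun_prop) _ _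
    _ ≤ ∫ w in (0 : ℝ)..r, Real.exp (-(2 * n * w ^ 2)) := by
        refine intervalIntegral.integral_mono_on hr0.le
          (Continuous.intervalIntegrable (by fun_prop) _ _) (hcont.intervalIntegrable _ _)
          fun w hw => ?_
        have h0 : 0 ≤ 1 - n * w ^ 2 := by
          rw [← hnr]
          have : w ^ 2 ≤ r ^ 2 := pow_le_pow_left₀ hw.1 hw.2 2
          nlinarith
        calc (1 - n * w ^ 2) ^ 2 ≤ Real.exp (-(n * w ^ 2)) ^ 2 :=
              pow_le_pow_left₀ h0 (Real.one_sub_le_exp_neg _) 2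
          _ = _ := by rw [← Real.exp_nat_mul]; congr 1; push_cast; ring
    _ ≤ _ := by
        refine intervalIntegral.integral_mono_interval le_rfl hr0.le hr1 ?_
          (hcont.intervalIntegrable _ _)
        exact Filter.Eventually.of_forall fun w => (Real.exp_pos _).le

/-- A unit window that contains the centre of a Gaussian has the least mass when the centre is an
endpoint. -/
theorem integral_exp_le_integral_exp_shift {n : ℝ} (hn : 0 ≤ n) {s d : ℝ} (h1 : s ≤ d)
    (h2 : d ≤ s + 1) :
    ∫ w in (0 : ℝ)..1, Real.exp (-(2 * n * w ^ 2)) ≤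
      ∫ u in s..s + 1, Real.exp (-(2 * n * (u - d) ^ 2)) := by
  set g : ℝ → ℝ := fun w => Real.exp (-(2 * n * w ^ 2)) with hg
  have hcont : Continuous g := by fun_prop
  have hint (a b : ℝ) : IntervalIntegrable g volume a b := hcont.intervalIntegrable a b
  have e1 : ∫ u in s..s + 1, Real.exp (-(2 * n * (u - d) ^ 2)) = ∫ w in s - d..s + 1 - d, g w :=
    intervalIntegral.integral_comp_sub_right g d
  have e2 : ∫ w in s - d..0, g w = ∫ w in s + 1 - d..1, g (w - (s + 1 - d)) := by
    -- Both sides are the integral of the even function `g` over an interval `[0, d - s]`.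
    rw [intervalIntegral.integral_comp_sub_right g, sub_self,
      show (1 : ℝ) - (s + 1 - d) = -(s - d) by ring, ← neg_zero, ← neg_zero,
      ← intervalIntegral.integral_comp_neg]
    simp [hg]
  rw [e1, ← intervalIntegral.integral_add_adjacent_intervals (hint (s - d) 0) (hint 0 _), e2,
    ← intervalIntegral.integral_add_adjacent_intervals (hint 0 (s + 1 - d)) (hint _ 1), add_comm]
  refine add_le_add_left ?_ _
  refine intervalIntegral.integral_mono_on (by linarith) (hint _ _)
    ((hcont.comp (continuous_sub_right _)).intervalIntegrable _ _) fun w hw => ?_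
  refine Real.exp_le_exp.2 (neg_le_neg ?_)
  have : (w - (s + 1 - d)) ^ 2 ≤ w ^ 2 :=
    pow_le_pow_left₀ (by linarith [hw.1]) (by linarith) 2
  exact mul_le_mul_of_nonneg_left this (by linarith)

/-- Linearization of a quadratic exponent: completing the square in `u` leaves a Gaussian integral
over a unit window around `d`, which is at least `1 / (2 √n)`. Restricting `u` to this window is
what yields the factor `√n`: over the whole line the right-hand side need not have a finite
expectation when all that is known of `d` is that it is sub-Gaussian with variance proxy
`1 / (4 n)`. -/
theorem exp_sq_le_integral_exp {n : ℝ} (hn : 1 ≤ n) {s d : ℝ} (h1 : s ≤ d) (h2 : d ≤ s + 1) :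
    Real.exp (2 * n * d ^ 2) ≤
      2 * √n * ∫ u in s..s + 1, Real.exp (4 * n * d * u - 2 * n * u ^ 2) := by
  have hs0 : 0 < √n := Real.sqrt_pos.2 (by linarith)
  have h := (half_inv_sqrt_le_integral_exp hn).trans
    (integral_exp_le_integral_exp_shift (by linarith) h1 h2)
  have e (u : ℝ) : Real.exp (4 * n * d * u - 2 * n * u ^ 2) =
      Real.exp (2 * n * d ^ 2) * Real.exp (-(2 * n * (u - d) ^ 2)) := by
    rw [← Real.exp_add]; congr 1; ring
  simp_rw [e]
  rw [intervalIntegral.integral_const_mul]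
  rw [div_le_iff₀ (by positivity)] at h
  calc Real.exp (2 * n * d ^ 2) = Real.exp (2 * n * d ^ 2) * 1 := (mul_one _).symm
    _ ≤ Real.exp (2 * n * d ^ 2) * _ := mul_le_mul_of_nonneg_left h (Real.exp_pos _).le
    _ = _ := by ring

/-! ### Exponential moments of an i.i.d. sample -/

theorem lintegral_pi_prod_le_one {Z : Type*} [MeasurableSpace Z] {n : ℕ} (ρ : Measure Z)
    [IsProbabilityMeasure ρ] {f : Z → ENNReal} (hf : Measurable f) (h : ∫⁻ z, f z ∂ρ ≤ 1) :
    ∫⁻ D, ∏ i, f (D i) ∂(Measure.pi fun _ : Fin n => ρ) ≤ 1 := by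
  have hind : iIndepFun (fun (i : Fin n) (D : Fin n → Z) => f (D i))
      (Measure.pi fun _ : Fin n => ρ) :=
    iIndepFun_pi (X := fun _ => f) fun _ => hf.aemeasurable
  rw [lintegral_prod_eq_prod_lintegral_of_indepFun _ _ hind
    fun i => hf.comp (measurable_pi_apply i)]
  refine Finset.prod_le_one (fun _ _ => zero_le) fun i _ => ?_
  rw [(measurePreserving_eval (fun _ : Fin n => ρ) i).lintegral_comp hf]
  exact h

/-- Hoeffding's lemma at `-4 u`, for a range of length one. -/
theorem lintegral_exp_mul_integral_sub_le_one {Z : Type*} [MeasurableSpace Z] (ρ : Measure Z)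
    [IsProbabilityMeasure ρ] {g : Z → ℝ} (hg : Measurable g) {a : ℝ}
    (hga : ∀ z, g z ∈ Set.Icc a (a + 1)) (u : ℝ) :
    ∫⁻ z, ENNReal.ofReal (Real.exp (4 * u * (∫ y, g y ∂ρ - g z) - 2 * u ^ 2)) ∂ρ ≤ 1 := by
  have hsub := hasSubgaussianMGF_of_mem_Icc (μ := ρ) hg.aemeasurable
    (Filter.Eventually.of_forall hga)
  have hint := hsub.integrable_exp_mul (-4 * u)
  have hmgf := hsub.mgf_le (-4 * u)
  have e (z : Z) : Real.exp (4 * u * (∫ y, g y ∂ρ - g z) - 2 * u ^ 2) =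
      Real.exp (-(2 * u ^ 2)) * Real.exp (-4 * u * (g z - ∫ y, g y ∂ρ)) := by
    rw [← Real.exp_add]; congr 1; ring
  simp_rw [e]
  rw [← ofReal_integral_eq_lintegral_ofReal (hint.const_mul _)
    (Filter.Eventually.of_forall fun z => by positivity), integral_const_mul]
  refine ENNReal.ofReal_le_one.2 ?_
  calc _ ≤ Real.exp (-(2 * u ^ 2)) * _ := mul_le_mul_of_nonneg_left hmgf (Real.exp_pos _).le
    _ = 1 := by
      rw [← Real.exp_add, Real.exp_eq_one_iff]
      simp
      ring

theorem integral_sub_average_mem_Icc {Z : Type*} [MeasurableSpace Z] (ρ : Measure Z) {n : ℕ}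
    (hn : 1 ≤ n) {g : Z → ℝ} {a : ℝ} (hga : ∀ z, g z ∈ Set.Icc a (a + 1)) (D : Fin n → Z) :
    ∫ y, g y ∂ρ - 1 / (n : ℝ) * ∑ i, g (D i) ∈
      Set.Icc (∫ y, g y ∂ρ - a - 1) (∫ y, g y ∂ρ - a - 1 + 1) := by
  have hn0 : (0 : ℝ) < n := by exact_mod_cast hn
  have h1 : (n : ℝ) * a ≤ ∑ i, g (D i) := by
    simpa using Finset.card_nsmul_le_sum Finset.univ (fun i => g (D i)) a fun i _ => (hga _).1
  have h2 : ∑ i, g (D i) ≤ n * (a + 1) := by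
    simpa [mul_add] using Finset.sum_le_card_nsmul Finset.univ (fun i => g (D i)) (a + 1)
      fun i _ => (hga _).2
  rw [one_div, ← div_eq_inv_mul]
  have h3 := (le_div_iff₀' hn0).2 h1
  have h4 := (div_le_iff₀' hn0).2 h2
  constructor <;> linarith

/-- The exponential moment behind McAllester's bound. The squared deviation is linearized by
`exp_sq_le_integral_exp`; the resulting exponential factorizes over the sample. -/
theorem lintegral_exp_sq_deviation_le {Z : Type*} [MeasurableSpace Z] (ρ : Measure Z)
    [IsProbabilityMeasure ρ] {n : ℕ} (hn : 1 ≤ n) {g : Z → ℝ} (hg : Measurable g) {a : ℝ}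
    (hga : ∀ z, g z ∈ Set.Icc a (a + 1)) :
    ∫⁻ D, ENNReal.ofReal
        (Real.exp (2 * n * (∫ y, g y ∂ρ - 1 / (n : ℝ) * ∑ i, g (D i)) ^ 2))
        ∂(Measure.pi fun _ : Fin n => ρ) ≤ ENNReal.ofReal (2 * √n) := by
  have hn0 : (n : ℝ) ≠ 0 := by positivity
  set m := ∫ y, g y ∂ρ with hm
  set s := m - a - 1
  set d : (Fin n → Z) → ℝ := fun D => m - 1 / (n : ℝ) * ∑ i, g (D i) with hd
  have hdm : Measurable d := by fun_prop
  have key (D : Fin n → Z) : ENNReal.ofReal (Real.exp (2 * n * d D ^ 2)) ≤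
      ENNReal.ofReal (2 * √n) * ∫⁻ u in Set.Ioc s (s + 1),
        ENNReal.ofReal (Real.exp (4 * n * d D * u - 2 * n * u ^ 2)) := by
    have hD := integral_sub_average_mem_Icc ρ hn hga D
    have hint : IntegrableOn (fun u => Real.exp (4 * n * d D * u - 2 * n * u ^ 2))
        (Set.Ioc s (s + 1)) :=
      (Continuous.integrableOn_Icc (by fun_prop)).mono_set Set.Ioc_subset_Icc_self
    rw [← ofReal_integral_eq_lintegral_ofReal hint
      (Filter.Eventually.of_forall fun u => (Real.exp_pos _).le),
      ← ENNReal.ofReal_mul (by positivity),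
      ← intervalIntegral.integral_of_le (by linarith)]
    exact ENNReal.ofReal_le_ofReal (exp_sq_le_integral_exp (by exact_mod_cast hn) hD.1 hD.2)
  calc _ ≤ ∫⁻ D, ENNReal.ofReal (2 * √n) * (∫⁻ u in Set.Ioc s (s + 1),
        ENNReal.ofReal (Real.exp (4 * n * d D * u - 2 * n * u ^ 2)))
          ∂(Measure.pi fun _ : Fin n => ρ) := lintegral_mono key
    _ = ENNReal.ofReal (2 * √n) * ∫⁻ u in Set.Ioc s (s + 1), (∫⁻ D,
        ENNReal.ofReal (Real.exp (4 * n * d D * u - 2 * n * u ^ 2))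
          ∂(Measure.pi fun _ : Fin n => ρ)) := by
        rw [lintegral_const_mul' _ _ ENNReal.ofReal_ne_top, lintegral_lintegral_swap]
        refine Measurable.aemeasurable ?_
        simp only [Function.uncurry_def]
        fun_prop
    _ ≤ ENNReal.ofReal (2 * √n) * ∫⁻ u in Set.Ioc s (s + 1), 1 := by
        refine mul_le_mul_right (lintegral_mono fun u => ?_) _
        have e (D : Fin n → Z) : ENNReal.ofReal (Real.exp (4 * n * d D * u - 2 * n * u ^ 2)) =
            ∏ i, ENNReal.ofReal (Real.exp (4 * u * (m - g (D i)) - 2 * u ^ 2)) := by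
          rw [← ENNReal.ofReal_prod_of_nonneg fun _ _ => (Real.exp_pos _).le, ← Real.exp_sum]
          congr 2
          simp only [hd, Finset.sum_sub_distrib, ← Finset.mul_sum, Finset.sum_const,
            Finset.card_univ, Fintype.card_fin, nsmul_eq_mul]
          field_simp
        simp_rw [e]
        exact lintegral_pi_prod_le_one ρ (by fun_prop)
          (lintegral_exp_mul_integral_sub_le_one ρ hg hga u)
    _ = ENNReal.ofReal (2 * √n) := by
        rw [setLIntegral_one, Real.volume_Ioc]; simp

/-- A deviation penalised by the observed square and a bound `v` on the second moment has
exponential moment at most one, for every `θ` and with no dependence on the almost sure bound `C`,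
which only guarantees integrability. -/
theorem lintegral_exp_self_normalized_le_one {Ω : Type*} [MeasurableSpace Ω] (μ : Measure Ω)
    [IsProbabilityMeasure μ] {Y : Ω → ℝ} (hY : Measurable Y) {C : ℝ} (hC : ∀ᵐ ω ∂μ, |Y ω| ≤ C)
    (θ : ℝ) {v : ℝ} (hv : ∫ ω, Y ω ^ 2 ∂μ ≤ v) :
    ∫⁻ ω, ENNReal.ofReal (Real.exp (θ * (Y ω - ∫ ω, Y ω ∂μ) - θ ^ 2 / 2 * (Y ω ^ 2 + v))) ∂μ
      ≤ 1 := by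
  set m := ∫ ω, Y ω ∂μ with hm
  have hYi : Integrable Y μ := Integrable.of_bound hY.aestronglyMeasurable C hC
  have hY2 : Integrable (fun ω => Y ω ^ 2) μ := by
    refine Integrable.of_bound (hY.pow_const 2).aestronglyMeasurable (C ^ 2) ?_
    filter_upwards [hC] with ω h
    rw [Real.norm_eq_abs, abs_pow]
    exact pow_le_pow_left₀ (abs_nonneg _) h 2
  have hle : ∀ ω, Real.exp (θ * (Y ω - m) - θ ^ 2 / 2 * (Y ω ^ 2 + v)) ≤
      Real.exp (-(θ * m + θ ^ 2 / 2 * v)) * (1 + θ * Y ω + θ ^ 2 / 2 * Y ω ^ 2) := fun ω => by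
    have h := exp_sub_sq_div_two_le (θ * Y ω)
    calc _ = Real.exp (-(θ * m + θ ^ 2 / 2 * v)) * Real.exp (θ * Y ω - (θ * Y ω) ^ 2 / 2) := by
          rw [← Real.exp_add]; congr 1; ring
      _ ≤ Real.exp (-(θ * m + θ ^ 2 / 2 * v)) * (1 + θ * Y ω + (θ * Y ω) ^ 2 / 2) :=
          mul_le_mul_of_nonneg_left h (Real.exp_pos _).le
      _ = _ := by ring
  have i1 : Integrable (fun ω => 1 + θ * Y ω) μ := (integrable_const _).add (hYi.const_mul _)
  have i2 : Integrable (fun ω => 1 + θ * Y ω + θ ^ 2 / 2 * Y ω ^ 2) μ := i1.add (hY2.const_mul _)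
  calc _ ≤ ∫⁻ ω, ENNReal.ofReal (Real.exp (-(θ * m + θ ^ 2 / 2 * v)) *
          (1 + θ * Y ω + θ ^ 2 / 2 * Y ω ^ 2)) ∂μ :=
        lintegral_mono fun ω => ENNReal.ofReal_le_ofReal (hle ω)
    _ = ENNReal.ofReal (Real.exp (-(θ * m + θ ^ 2 / 2 * v)) *
          (1 + θ * m + θ ^ 2 / 2 * ∫ ω, Y ω ^ 2 ∂μ)) := by
        rw [← ofReal_integral_eq_lintegral_ofReal (i2.const_mul _)
          (Filter.Eventually.of_forall fun ω => (Real.exp_pos _).le.trans (hle ω)),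
          integral_const_mul, integral_add i1 (hY2.const_mul _),
          integral_add (integrable_const _) (hYi.const_mul _), integral_const_mul,
          integral_const_mul]
        simp [hm]
    _ ≤ 1 := by
        refine ENNReal.ofReal_le_one.2 ?_
        have h1 : θ ^ 2 / 2 * ∫ ω, Y ω ^ 2 ∂μ ≤ θ ^ 2 / 2 * v :=
          mul_le_mul_of_nonneg_left hv (by positivity)
        have h2 := Real.add_one_le_exp (θ * m + θ ^ 2 / 2 * v)
        calc _ ≤ Real.exp (-(θ * m + θ ^ 2 / 2 * v)) * Real.exp (θ * m + θ ^ 2 / 2 * v) :=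
              mul_le_mul_of_nonneg_left (by linarith) (Real.exp_pos _).le
          _ = 1 := by rw [← Real.exp_add]; simp

/-! ### Change of measure -/

/-- The Donsker-Varadhan inequality: the Kullback-Leibler divergence of `Q` from the tilted measure
`P.tilted f` is nonnegative. -/
theorem integral_le_klDiv_add_log_integral_exp {H : Type*} [MeasurableSpace H] {P Q : Measure H}
    [IsProbabilityMeasure P] [IsProbabilityMeasure Q] (hKL : InformationTheory.klDiv Q P ≠ ⊤)
    {f : H → ℝ} (hfQ : Integrable f Q) (hfP : Integrable (fun h => Real.exp (f h)) P) :
    ∫ h, f h ∂Q ≤ (InformationTheory.klDiv Q P).toReal + Real.log (∫ h, Real.exp (f h) ∂P) := by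
  obtain ⟨hac, hllr⟩ := InformationTheory.klDiv_ne_top_iff.1 hKL
  have : IsProbabilityMeasure (P.tilted f) := isProbabilityMeasure_tilted hfP
  have h1 := integral_llr_tilted_right hac hfQ hfP hllr
  have h2 : 0 ≤ ∫ h, llr Q (P.tilted f) h ∂Q := by
    have := InformationTheory.integral_llr_add_sub_measure_univ_nonneg
      (hac.trans (absolutelyContinuous_tilted hfP)) (integrable_llr_tilted_right hac hfQ hllr hfP)
    simpa using this
  have h3 := InformationTheory.toReal_klDiv_of_measure_eq hac (by simp)
  linarith

/-- An exponential moment bound that holds for each fixed `h` holds on one event simultaneously for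
all `Q`, at the price of the divergence from `P`. -/
theorem exists_pacBayes_event {Ω H : Type*} [MeasurableSpace Ω] [MeasurableSpace H]
    (M : Measure Ω) [IsProbabilityMeasure M] (P : Measure H) [IsProbabilityMeasure P]
    {φ : Ω → H → ℝ} (hφ : Measurable (Function.uncurry φ)) (hb : ∀ ω, ∃ C, ∀ h, |φ ω h| ≤ C)
    {B ε : ℝ} (hB : 0 < B) (hε : 0 < ε)
    (hexp : ∀ h, ∫⁻ ω, ENNReal.ofReal (Real.exp (φ ω h)) ∂M ≤ ENNReal.ofReal B) :
    ∃ E : Set Ω, MeasurableSet E ∧ M Eᶜ ≤ ENNReal.ofReal ε ∧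
      ∀ ω ∈ E, ∀ (Q : Measure H) [IsProbabilityMeasure Q], InformationTheory.klDiv Q P ≠ ⊤ →
        ∫ h, φ ω h ∂Q ≤ (InformationTheory.klDiv Q P).toReal + Real.log (B / ε) := by
  set F : Ω → ENNReal := fun ω => ∫⁻ h, ENNReal.ofReal (Real.exp (φ ω h)) ∂P with hF
  have hφe : Measurable fun z : Ω × H => ENNReal.ofReal (Real.exp (φ z.1 z.2)) :=
    (Real.measurable_exp.comp hφ).ennreal_ofReal
  have hFm : Measurable F := hφe.lintegral_prod_right'
  refine ⟨{ω | F ω ≤ ENNReal.ofReal (B / ε)}, measurableSet_le hFm measurable_const, ?_, ?_⟩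
  · have h1 : ∫⁻ ω, F ω ∂M ≤ ENNReal.ofReal B := by
      rw [hF, lintegral_lintegral_swap hφe.aemeasurable]
      calc _ ≤ ∫⁻ _, ENNReal.ofReal B ∂P := lintegral_mono hexp
        _ = _ := by simp
    calc M {ω | F ω ≤ ENNReal.ofReal (B / ε)}ᶜ ≤ M {ω | ENNReal.ofReal (B / ε) ≤ F ω} :=
          measure_mono fun ω hω => le_of_lt (not_le.1 (show ¬F ω ≤ _ from hω))
      _ ≤ (∫⁻ ω, F ω ∂M) / ENNReal.ofReal (B / ε) :=
          meas_ge_le_lintegral_div hFm.aemeasurable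
            (ENNReal.ofReal_pos.2 (by positivity)).ne' ENNReal.ofReal_ne_top
      _ ≤ ENNReal.ofReal B / ENNReal.ofReal (B / ε) := ENNReal.div_le_div_right h1 _
      _ = ENNReal.ofReal ε := by
          rw [← ENNReal.ofReal_div_of_pos (by positivity)]
          congr 1
          field_simp
  · intro ω hω Q _ hKL
    obtain ⟨C, hC⟩ := hb ω
    have hm : Measurable (φ ω) := hφ.comp measurable_prodMk_left
    have hfQ : Integrable (φ ω) Q :=
      Integrable.of_bound hm.aestronglyMeasurable C (Filter.Eventually.of_forall hC)
    have hfP : Integrable (fun h => Real.exp (φ ω h)) P := by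
      refine Integrable.of_bound hm.exp.aestronglyMeasurable (Real.exp C)
        (Filter.Eventually.of_forall fun h => ?_)
      rw [Real.norm_eq_abs, Real.abs_exp]
      exact Real.exp_le_exp.2 ((le_abs_self _).trans (hC h))
    refine (integral_le_klDiv_add_log_integral_exp hKL hfQ hfP).trans
      (add_le_add le_rfl (Real.log_le_log (integral_exp_pos hfP) ?_))
    have h2 : ENNReal.ofReal (∫ h, Real.exp (φ ω h) ∂P) ≤ ENNReal.ofReal (B / ε) := by
      rw [ofReal_integral_eq_lintegral_ofReal hfP
        (Filter.Eventually.of_forall fun h => (Real.exp_pos _).le)]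
      exact hω
    exact (ENNReal.ofReal_le_ofReal_iff (by positivity)).1 h2

/-! ### Costs, scores and induced policies -/

variable {X H : Type*} [MeasurableSpace X] [MeasurableSpace H] {K : ℕ}

/-- The mean cost `E_{c ∼ p(· | x, a)}[c]` of action `a` in context `x`. -/
noncomputable def meanCost (p : Kernel (X × Fin K) ℝ) (x : X) (a : Fin K) : ℝ :=
  ∫ c, c ∂(p (x, a))

/-- The contribution of one data point `z = (x, a, c)` to the exponent of the self-normalized
bound, for a predictor playing `b` in context `x`: with `w = π₀(b | x)`, `θ` times the centred
importance-weighted cost, minus `θ ^ 2 / 2` times the sum of its square and of the bound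
`w / w ^ (2 * α)` on its second moment given `x`. The quotients are not simplified to powers of
`w`, so that an action with `w = 0` contributes zero, as it does to expectations under `π₀`. -/
noncomputable def score (π₀ : Kernel X (Fin K)) (p : Kernel (X × Fin K) ℝ) (α θ : ℝ)
    (z : X × Fin K × ℝ) (b : Fin K) : ℝ :=
  θ * ((if b = z.2.1 then z.2.2 / prob π₀ b z.1 ^ α else 0) -
      prob π₀ b z.1 / prob π₀ b z.1 ^ α * meanCost p z.1 b) -
    θ ^ 2 / 2 * ((if b = z.2.1 then z.2.2 ^ 2 / prob π₀ b z.1 ^ (2 * α) else 0) +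
      prob π₀ b z.1 / prob π₀ b z.1 ^ (2 * α))

theorem measurable_prob (π : Kernel X (Fin K)) :
    Measurable fun y : X × Fin K => prob π y.2 y.1 :=
  measurable_from_prod_countable_left fun a =>
    (Kernel.measurable_coe π (measurableSet_singleton a)).ennreal_toReal

theorem measurable_meanCost (p : Kernel (X × Fin K) ℝ) [IsMarkovKernel p] :
    Measurable fun y : X × Fin K => meanCost p y.1 y.2 :=
  (stronglyMeasurable_id.integral_kernel (κ := p)).measurable

theorem measurable_score (π₀ : Kernel X (Fin K)) (p : Kernel (X × Fin K) ℝ) [IsMarkovKernel p]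
    (α θ : ℝ) : Measurable fun y : (X × Fin K × ℝ) × Fin K => score π₀ p α θ y.1 y.2 := by
  have h1 : Measurable fun y : (X × Fin K × ℝ) × Fin K => prob π₀ y.2 y.1.1 :=
    (measurable_prob π₀).comp (by fun_prop : Measurable fun y : (X × Fin K × ℝ) × Fin K =>
      (y.1.1, y.2))
  have h2 : Measurable fun y : (X × Fin K × ℝ) × Fin K => meanCost p y.1.1 y.2 :=
    (measurable_meanCost p).comp (by fun_prop : Measurable fun y : (X × Fin K × ℝ) × Fin K =>
      (y.1.1, y.2))
  have hs : MeasurableSet {y : (X × Fin K × ℝ) × Fin K | y.2 = y.1.2.1} :=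
    measurableSet_eq_fun (by fun_prop) (by fun_prop)
  have h3 : Measurable fun y : (X × Fin K × ℝ) × Fin K =>
      if y.2 = y.1.2.1 then y.1.2.2 / prob π₀ y.2 y.1.1 ^ α else 0 :=
    Measurable.ite hs (by fun_prop) measurable_const
  have h4 : Measurable fun y : (X × Fin K × ℝ) × Fin K =>
      if y.2 = y.1.2.1 then y.1.2.2 ^ 2 / prob π₀ y.2 y.1.1 ^ (2 * α) else 0 :=
    Measurable.ite hs (by fun_prop) measurable_const
  unfold score
  fun_prop

theorem meanCost_mem_Icc {p : Kernel (X × Fin K) ℝ} [IsMarkovKernel p]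
    (hp : ∀ x a, ∀ᵐ c ∂(p (x, a)), c ∈ Set.Icc (-1 : ℝ) 0) (x : X) (a : Fin K) :
    meanCost p x a ∈ Set.Icc (-1 : ℝ) 0 := by
  have hi : Integrable (fun c : ℝ => c) (p (x, a)) :=
    Integrable.of_mem_Icc (-1) 0 aemeasurable_id (hp x a)
  constructor
  · calc (-1 : ℝ) = ∫ _, (-1 : ℝ) ∂(p (x, a)) := by simp
      _ ≤ _ := integral_mono_ae (integrable_const _) hi ((hp x a).mono fun c hc => hc.1)
  · exact integral_nonpos_of_ae ((hp x a).mono fun c hc => hc.2)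

theorem prob_nonneg (π : Kernel X (Fin K)) (a : Fin K) (x : X) : 0 ≤ prob π a x :=
  measureReal_nonneg

theorem integral_policy_eq_sum (π : Kernel X (Fin K)) [IsMarkovKernel π] (x : X)
    (f : Fin K → ℝ) : ∫ a, f a ∂(π x) = ∑ a, prob π a x * f a := by
  rw [integral_fintype Integrable.of_finite]
  rfl

theorem sum_prob (π : Kernel X (Fin K)) [IsMarkovKernel π] (x : X) : ∑ a, prob π a x = 1 := by
  have := integral_policy_eq_sum π x fun _ => 1
  simpa using this.symm

instance {pred : H → X → Fin K} {hpred : Measurable (Function.uncurry pred)} {Q : Measure H}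
    [IsProbabilityMeasure Q] : IsMarkovKernel (inducedPolicy pred hpred Q) :=
  ⟨fun _ => Measure.isProbabilityMeasure_map
    (hpred.comp (measurable_id.prodMk measurable_const)).aemeasurable⟩

theorem integral_comp_pred {pred : H → X → Fin K} (hpred : Measurable (Function.uncurry pred))
    (Q : Measure H) [IsProbabilityMeasure Q] (x : X) (w : Fin K → ℝ) :
    ∫ h, w (pred h x) ∂Q = ∑ b, prob (inducedPolicy pred hpred Q) b x * w b := by
  rw [← integral_policy_eq_sum]
  exact (integral_map (hpred.comp (measurable_id.prodMk measurable_const)).aemeasurable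
    (Measurable.of_discrete (f := w)).aestronglyMeasurable).symm

instance {ν : Measure X} [IsProbabilityMeasure ν] {π : Kernel X (Fin K)} [IsMarkovKernel π]
    {p : Kernel (X × Fin K) ℝ} [IsMarkovKernel p] : IsProbabilityMeasure (jointLaw ν π p) := by
  unfold jointLaw
  infer_instance

theorem integral_fst_jointLaw (ν : Measure X) [IsProbabilityMeasure ν] (π : Kernel X (Fin K))
    [IsMarkovKernel π] (p : Kernel (X × Fin K) ℝ) [IsMarkovKernel p] {f : X → ℝ}
    (hf : Measurable f) : ∫ z, f z.1 ∂(jointLaw ν π p) = ∫ x, f x ∂ν := by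
  have h : (jointLaw ν π p).map Prod.fst = ν := Measure.fst_compProd ν (π ⊗ₖ p)
  rw [← integral_map measurable_fst.aemeasurable hf.aestronglyMeasurable, h]

theorem ae_cost_mem_Icc (π : Kernel X (Fin K)) [IsMarkovKernel π] {p : Kernel (X × Fin K) ℝ}
    [IsMarkovKernel p] (hp : ∀ x a, ∀ᵐ c ∂(p (x, a)), c ∈ Set.Icc (-1 : ℝ) 0) (x : X) :
    ∀ᵐ y ∂((π ⊗ₖ p) x), y.2 ∈ Set.Icc (-1 : ℝ) 0 :=
  (Kernel.ae_compProd_iff (measurable_snd measurableSet_Icc)).2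
    (Filter.Eventually.of_forall fun a => hp x a)

theorem risk_eq_integral (ν : Measure X) [IsProbabilityMeasure ν] (π : Kernel X (Fin K))
    [IsMarkovKernel π] {p : Kernel (X × Fin K) ℝ} [IsMarkovKernel p]
    (hp : ∀ x a, ∀ᵐ c ∂(p (x, a)), c ∈ Set.Icc (-1 : ℝ) 0) :
    risk ν p π = ∫ x, ∑ b, prob π b x * meanCost p x b ∂ν := by
  have hm : Measurable fun z : X × Fin K × ℝ => z.2.2 := by fun_prop
  have hi : Integrable (fun z : X × Fin K × ℝ => z.2.2) (ν ⊗ₘ (π ⊗ₖ p)) :=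
    Integrable.of_mem_Icc (-1) 0 hm.aemeasurable
      (Measure.ae_compProd_of_ae_ae (hm measurableSet_Icc)
        (Filter.Eventually.of_forall fun x => ae_cost_mem_Icc π hp x))
  rw [risk, jointLaw, Measure.integral_compProd hi]
  congr 1 with x
  rw [integral_compProd (Integrable.of_mem_Icc (-1) 0 measurable_snd.aemeasurable
    (ae_cost_mem_Icc π hp x)), integral_policy_eq_sum]
  rfl

/-! ### The two exponential moments -/

/-- The self-normalized bound is applied conditionally on the context, given which the
importance-weighted cost `Y` is bounded. -/
theorem lintegral_exp_score_le_one (ν : Measure X) [IsProbabilityMeasure ν]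
    (π₀ : Kernel X (Fin K)) [IsMarkovKernel π₀] {p : Kernel (X × Fin K) ℝ} [IsMarkovKernel p]
    (hp : ∀ x a, ∀ᵐ c ∂(p (x, a)), c ∈ Set.Icc (-1 : ℝ) 0) (α θ : ℝ) {g : X → Fin K}
    (hg : Measurable g) :
    ∫⁻ z, ENNReal.ofReal (Real.exp (score π₀ p α θ z (g z.1))) ∂(jointLaw ν π₀ p) ≤ 1 := by
  have hm : Measurable fun z : X × Fin K × ℝ => score π₀ p α θ z (g z.1) :=
    (measurable_score π₀ p α θ).comp (measurable_id.prodMk (hg.comp measurable_fst))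
  rw [jointLaw, Measure.lintegral_compProd hm.exp.ennreal_ofReal]
  suffices h : ∀ x, ∫⁻ y, ENNReal.ofReal (Real.exp (score π₀ p α θ (x, y) (g x)))
      ∂((π₀ ⊗ₖ p) x) ≤ 1 by
    calc _ ≤ ∫⁻ _, 1 ∂ν := lintegral_mono h
      _ = 1 := by simp
  intro x
  set b := g x
  set w := prob π₀ b x with hw
  have hw0 : 0 ≤ w := prob_nonneg _ _ _
  set Y : Fin K × ℝ → ℝ := fun y => if b = y.1 then y.2 / w ^ α else 0 with hY
  have hYm : Measurable Y :=
    Measurable.ite (measurableSet_eq_fun measurable_const measurable_fst) (by fun_prop)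
      measurable_const
  have hY2 (y : Fin K × ℝ) : Y y ^ 2 = if b = y.1 then y.2 ^ 2 / w ^ (2 * α) else 0 := by
    have : w ^ (2 * α) = (w ^ α) ^ 2 := by
      rw [mul_comm, Real.rpow_mul hw0, Real.rpow_two]
    simp only [hY]
    split_ifs
    · rw [div_pow, this]
    · simp
  have hC : ∀ᵐ y ∂((π₀ ⊗ₖ p) x), |Y y| ≤ 1 / w ^ α := by
    filter_upwards [ae_cost_mem_Icc π₀ hp x] with y hy
    have hwα : 0 ≤ w ^ α := Real.rpow_nonneg hw0 _
    simp only [hY]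
    split_ifs
    · rw [abs_div, abs_of_nonneg hwα]
      exact div_le_div_of_nonneg_right (abs_le.2 ⟨hy.1, hy.2.trans zero_le_one⟩) hwα
    · simpa using hwα
  have hYi : Integrable Y ((π₀ ⊗ₖ p) x) := Integrable.of_bound hYm.aestronglyMeasurable _ hC
  have hY2i : Integrable (fun y => Y y ^ 2) ((π₀ ⊗ₖ p) x) := by
    refine Integrable.of_bound (hYm.pow_const 2).aestronglyMeasurable ((1 / w ^ α) ^ 2) ?_
    filter_upwards [hC] with y h
    rw [Real.norm_eq_abs, abs_pow]
    exact pow_le_pow_left₀ (abs_nonneg _) h 2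
  have hmean : ∫ y, Y y ∂((π₀ ⊗ₖ p) x) = w / w ^ α * meanCost p x b := by
    rw [integral_compProd hYi, integral_policy_eq_sum]
    have (a : Fin K) : ∫ c, Y (a, c) ∂(p (x, a)) =
        if b = a then meanCost p x a / w ^ α else 0 := by
      simp only [hY]
      split_ifs
      · rw [integral_div]; rfl
      · simp
    simp only [this, mul_ite, mul_zero, Finset.sum_ite_eq, Finset.mem_univ, if_true, ← hw]
    ring
  have hsq : ∫ y, Y y ^ 2 ∂((π₀ ⊗ₖ p) x) ≤ w / w ^ (2 * α) := by
    rw [integral_compProd hY2i, integral_policy_eq_sum]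
    have h2α : 0 ≤ w ^ (2 * α) := Real.rpow_nonneg hw0 _
    have (a : Fin K) : ∫ c, Y (a, c) ^ 2 ∂(p (x, a)) ≤
        if b = a then 1 / w ^ (2 * α) else 0 := by
      simp only [hY2]
      split_ifs
      · have hle : ∀ᵐ c ∂(p (x, a)), c ^ 2 / w ^ (2 * α) ≤ 1 / w ^ (2 * α) := by
          filter_upwards [hp x a] with c hc
          exact div_le_div_of_nonneg_right (by nlinarith [hc.1, hc.2]) h2α
        calc _ ≤ ∫ _, 1 / w ^ (2 * α) ∂(p (x, a)) :=
              integral_mono_of_nonneg (Filter.Eventually.of_forall fun c => by positivity)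
                (integrable_const _) hle
          _ = _ := by simp
      · simp
    calc _ ≤ ∑ a, prob π₀ a x * (if b = a then 1 / w ^ (2 * α) else 0) :=
          Finset.sum_le_sum fun a _ => mul_le_mul_of_nonneg_left (this a) (prob_nonneg _ _ _)
      _ = w / w ^ (2 * α) := by simp [← hw, div_eq_mul_inv]
  have h := lintegral_exp_self_normalized_le_one ((π₀ ⊗ₖ p) x) hYm hC θ hsq
  rw [hmean] at h
  simp only [hY2] at h
  exact h

/-- Averaging over `Q` turns the predictor's action into the induced policy, because each score is
a function of the action alone once the data are fixed. -/
theorem exists_score_event (ν : Measure X) [IsProbabilityMeasure ν]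
    (π₀ : Kernel X (Fin K)) [IsMarkovKernel π₀] {p : Kernel (X × Fin K) ℝ} [IsMarkovKernel p]
    (hp : ∀ x a, ∀ᵐ c ∂(p (x, a)), c ∈ Set.Icc (-1 : ℝ) 0)
    {pred : H → X → Fin K} (hpred : Measurable (Function.uncurry pred))
    (P : Measure H) [IsProbabilityMeasure P] (n : ℕ) (α θ : ℝ) {ε : ℝ} (hε : 0 < ε) :
    ∃ E : Set (Fin n → X × Fin K × ℝ), MeasurableSet E ∧
      Measure.pi (fun _ : Fin n => jointLaw ν π₀ p) Eᶜ ≤ ENNReal.ofReal ε ∧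
      ∀ D ∈ E, ∀ (Q : Measure H) [IsProbabilityMeasure Q], InformationTheory.klDiv Q P ≠ ⊤ →
        ∑ i, ∑ b, prob (inducedPolicy pred hpred Q) b (D i).1 * score π₀ p α θ (D i) b ≤
          (InformationTheory.klDiv Q P).toReal + Real.log (1 / ε) := by
  have hx (h : H) : Measurable (pred h) := hpred.comp measurable_prodMk_left
  have hm : Measurable fun y : (Fin n → X × Fin K × ℝ) × H =>
      ∑ i, score π₀ p α θ (y.1 i) (pred y.2 (y.1 i).1) := by
    refine Finset.measurable_sum _ fun i _ => ?_
    have h1 : Measurable fun y : (Fin n → X × Fin K × ℝ) × H => y.1 i := by fun_prop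
    exact (measurable_score π₀ p α θ).comp
      (h1.prodMk (hpred.comp (measurable_snd.prodMk h1.fst)))
  obtain ⟨E, hE, hPE, hD⟩ := exists_pacBayes_event
    (Measure.pi fun _ : Fin n => jointLaw ν π₀ p) P
    (φ := fun D h => ∑ i, score π₀ p α θ (D i) (pred h (D i).1)) hm
    (fun D => by
      -- For fixed data the exponent depends on `h` only through `n` actions.
      obtain ⟨C, hC⟩ := (Set.finite_range fun y : Fin n → Fin K =>
        |∑ i, score π₀ p α θ (D i) (y i)|).bddAbove
      exact ⟨C, fun h => hC ⟨fun i => pred h (D i).1, rfl⟩⟩)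
    zero_lt_one hε (fun h => by
      simp_rw [Real.exp_sum, ENNReal.ofReal_prod_of_nonneg fun _ _ => (Real.exp_pos _).le,
        ENNReal.ofReal_one]
      refine lintegral_pi_prod_le_one (jointLaw ν π₀ p)
        (f := fun z => ENNReal.ofReal (Real.exp (score π₀ p α θ z (pred h z.1)))) ?_
        (lintegral_exp_score_le_one ν π₀ hp α θ (hx h))
      exact ((measurable_score π₀ p α θ).comp
        (measurable_id.prodMk ((hx h).comp measurable_fst))).exp.ennreal_ofReal)
  refine ⟨E, hE, hPE, fun D hDE Q _ hKL => ?_⟩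
  have h := hD D hDE Q hKL
  rw [integral_finsetSum] at h
  · simpa only [integral_comp_pred hpred] using h
  · intro i _
    have hmi : Measurable fun h => pred h (D i).1 :=
      hpred.comp (measurable_id.prodMk measurable_const)
    obtain ⟨C, hC⟩ := (Set.finite_range fun b : Fin K => |score π₀ p α θ (D i) b|).bddAbove
    exact Integrable.of_bound
      ((Measurable.of_discrete (f := score π₀ p α θ (D i))).comp hmi).aestronglyMeasurable C
      (Filter.Eventually.of_forall fun h => hC ⟨pred h (D i).1, rfl⟩)

/-- Jensen's inequality moves the average over `Q` inside the square. -/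
theorem exists_risk_event (ν : Measure X) [IsProbabilityMeasure ν]
    (π₀ : Kernel X (Fin K)) [IsMarkovKernel π₀] {p : Kernel (X × Fin K) ℝ} [IsMarkovKernel p]
    (hp : ∀ x a, ∀ᵐ c ∂(p (x, a)), c ∈ Set.Icc (-1 : ℝ) 0)
    {pred : H → X → Fin K} (hpred : Measurable (Function.uncurry pred))
    (P : Measure H) [IsProbabilityMeasure P] {n : ℕ} (hn : 1 ≤ n) {ε : ℝ} (hε : 0 < ε) :
    ∃ E : Set (Fin n → X × Fin K × ℝ), MeasurableSet E ∧
      Measure.pi (fun _ : Fin n => jointLaw ν π₀ p) Eᶜ ≤ ENNReal.ofReal ε ∧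
      ∀ D ∈ E, ∀ (Q : Measure H) [IsProbabilityMeasure Q], InformationTheory.klDiv Q P ≠ ⊤ →
        2 * n * (risk ν p (inducedPolicy pred hpred Q) - 1 / (n : ℝ) * ∑ i, ∑ b,
          prob (inducedPolicy pred hpred Q) b (D i).1 * meanCost p (D i).1 b) ^ 2 ≤
        (InformationTheory.klDiv Q P).toReal + Real.log (2 * √n / ε) := by
  have hn0 : (0 : ℝ) < n := by exact_mod_cast hn
  set L := jointLaw ν π₀ p
  have hcost (x : X) (a : Fin K) : meanCost p x a ∈ Set.Icc (-1 : ℝ) (-1 + 1) := by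
    simpa using meanCost_mem_Icc hp x a
  have hpm : Measurable fun y : H × (X × Fin K × ℝ) => meanCost p y.2.1 (pred y.1 y.2.1) := by
    have h1 : Measurable fun y : H × (X × Fin K × ℝ) => y.2.1 := by fun_prop
    exact (measurable_meanCost p).comp (h1.prodMk (hpred.comp (measurable_fst.prodMk h1)))
  set r : H → ℝ := fun h => ∫ z, meanCost p z.1 (pred h z.1) ∂L with hr
  have hrm : Measurable r := hpm.stronglyMeasurable.integral_prod_right'.measurable
  set d : (Fin n → X × Fin K × ℝ) → H → ℝ := fun D h =>
    r h - 1 / (n : ℝ) * ∑ i, meanCost p (D i).1 (pred h (D i).1) with hd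
  have hdm : Measurable (Function.uncurry d) := by
    have h1 (i : Fin n) : Measurable fun y : (Fin n → X × Fin K × ℝ) × H =>
        meanCost p (y.1 i).1 (pred y.2 (y.1 i).1) :=
      hpm.comp (measurable_snd.prodMk ((measurable_pi_apply i).comp measurable_fst))
    exact (hrm.comp measurable_snd).sub
      ((Finset.measurable_sum _ fun i _ => h1 i).const_mul _)
  have hpmh (h : H) : Measurable fun z : X × Fin K × ℝ => meanCost p z.1 (pred h z.1) :=
    hpm.comp measurable_prodMk_left
  have hr01 (h : H) : r h ∈ Set.Icc (-1 : ℝ) 0 := by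
    have hi : Integrable (fun z : X × Fin K × ℝ => meanCost p z.1 (pred h z.1)) L :=
      Integrable.of_mem_Icc (-1) 0 (hpmh h).aemeasurable
        (Filter.Eventually.of_forall fun z => meanCost_mem_Icc hp _ _)
    constructor
    · calc (-1 : ℝ) = ∫ _, (-1 : ℝ) ∂L := by simp
        _ ≤ _ := integral_mono (integrable_const _) hi fun z => (hcost _ _).1
    · exact integral_nonpos fun z => (meanCost_mem_Icc hp _ _).2
  have hd1 (D : Fin n → X × Fin K × ℝ) (h : H) : |d D h| ≤ 1 := by
    have h1 := integral_sub_average_mem_Icc L hn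
      (g := fun z => meanCost p z.1 (pred h z.1)) (a := -1) (fun z => hcost _ _) D
    have h2 := hr01 h
    exact abs_le.2 ⟨by linarith [h1.1, h2.1], by linarith [h1.2, h2.2]⟩
  obtain ⟨E, hE, hPE, hD⟩ := exists_pacBayes_event (Measure.pi fun _ : Fin n => L) P
    (φ := fun D h => 2 * n * d D h ^ 2) ((hdm.pow_const 2).const_mul _)
    (fun D => ⟨2 * n, fun h => by
      rw [abs_mul, abs_pow, abs_of_nonneg (by positivity)]
      exact mul_le_of_le_one_right (by positivity) (pow_le_one₀ (abs_nonneg _) (hd1 D h))⟩)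
    (by positivity : 0 < 2 * √(n : ℝ)) hε
    (fun h => lintegral_exp_sq_deviation_le L hn (hpmh h) fun z => hcost _ _)
  refine ⟨E, hE, hPE, fun D hDE Q _ hKL => le_trans ?_ (hD D hDE Q hKL)⟩
  have hdmD : Measurable (d D) := hdm.comp measurable_prodMk_left
  have hmem : MemLp (d D) 2 Q :=
    MemLp.of_bound hdmD.aestronglyMeasurable 1 (Filter.Eventually.of_forall (hd1 D))
  have hjensen : (∫ h, d D h ∂Q) ^ 2 ≤ ∫ h, d D h ^ 2 ∂Q := by
    have h1 := variance_nonneg (d D) Q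
    rw [variance_eq_sub hmem] at h1
    simpa using h1
  have hmean : ∫ h, d D h ∂Q = risk ν p (inducedPolicy pred hpred Q) - 1 / (n : ℝ) * ∑ i, ∑ b,
      prob (inducedPolicy pred hpred Q) b (D i).1 * meanCost p (D i).1 b := by
    have hmi (i : Fin n) : Integrable (fun h => meanCost p (D i).1 (pred h (D i).1)) Q :=
      Integrable.of_mem_Icc (-1) 0 (hpm.comp measurable_prodMk_right).aemeasurable
        (Filter.Eventually.of_forall fun h => meanCost_mem_Icc hp _ _)
    have hri : Integrable r Q :=
      Integrable.of_mem_Icc (-1) 0 hrm.aemeasurable (Filter.Eventually.of_forall hr01)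
    have hrint : ∫ h, r h ∂Q = risk ν p (inducedPolicy pred hpred Q) := by
      rw [risk_eq_integral ν _ hp, hr, integral_integral_swap]
      · simp_rw [integral_comp_pred hpred]
        refine integral_fst_jointLaw ν π₀ p (f := fun x => ∑ b,
          prob (inducedPolicy pred hpred Q) b x * meanCost p x b) ?_
        refine Finset.measurable_sum _ fun b _ => Measurable.mul ?_ ?_
        · exact (measurable_prob (inducedPolicy pred hpred Q)).comp measurable_prodMk_right
        · exact (measurable_meanCost p).comp measurable_prodMk_right
      · exact Integrable.of_mem_Icc (-1) 0 hpm.aemeasurable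
          (Filter.Eventually.of_forall fun y => meanCost_mem_Icc hp _ _)
    rw [hd, integral_sub hri ((integrable_finsetSum _ fun i _ => hmi i).const_mul _),
      integral_const_mul, integral_finsetSum _ fun i _ => hmi i, hrint]
    simp_rw [integral_comp_pred hpred]
  rw [← hmean, integral_const_mul]
  exact mul_le_mul_of_nonneg_left hjensen (by positivity)

/-! ### Assembling the bound -/

/-- The average score of a randomized policy `q`, in the form in which the estimator and the
second-moment term are defined. -/
theorem sum_prob_mul_score {π₀ : Kernel X (Fin K)} [IsMarkovKernel π₀]
    (p : Kernel (X × Fin K) ℝ) (α θ : ℝ) (z : X × Fin K × ℝ) (q : Fin K → ℝ) :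
    ∑ b, q b * score π₀ p α θ z b =
      θ * (z.2.2 * (q z.2.1 / prob π₀ z.2.1 z.1 ^ α) -
        ∑ b, q b * (prob π₀ b z.1 / prob π₀ b z.1 ^ α * meanCost p z.1 b)) -
      θ ^ 2 / 2 * ((∫ a, q a / prob π₀ a z.1 ^ (2 * α) ∂(π₀ z.1)) +
        q z.2.1 * z.2.2 ^ 2 / prob π₀ z.2.1 z.1 ^ (2 * α)) := by
  rw [integral_policy_eq_sum]
  have h (b : Fin K) : q b * score π₀ p α θ z b =
      θ * ((if b = z.2.1 then q b * (z.2.2 / prob π₀ b z.1 ^ α) else 0) -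
        q b * (prob π₀ b z.1 / prob π₀ b z.1 ^ α * meanCost p z.1 b)) -
      θ ^ 2 / 2 * (prob π₀ b z.1 * (q b / prob π₀ b z.1 ^ (2 * α)) +
        (if b = z.2.1 then q b * (z.2.2 ^ 2 / prob π₀ b z.1 ^ (2 * α)) else 0)) := by
    unfold score
    split_ifs <;> ring
  simp only [h, Finset.sum_sub_distrib, ← Finset.mul_sum, Finset.sum_add_distrib,
    Finset.sum_ite_eq', Finset.mem_univ, if_true]
  ring

theorem abs_smoothing_bias_le {π₀ π : Kernel X (Fin K)} [IsMarkovKernel π₀] [IsMarkovKernel π]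
    {p : Kernel (X × Fin K) ℝ} [IsMarkovKernel p]
    (hp : ∀ x a, ∀ᵐ c ∂(p (x, a)), c ∈ Set.Icc (-1 : ℝ) 0) {α : ℝ} (hα : α ≤ 1) (x : X)
    (hover : α = 1 → ∀ a, prob π₀ a x = 0 → prob π a x = 0) :
    |∑ b, prob π b x * meanCost p x b -
        ∑ b, prob π b x * (prob π₀ b x / prob π₀ b x ^ α * meanCost p x b)| ≤
      1 - ∫ a, prob π₀ a x ^ (1 - α) ∂(π x) := by
  have hB : 1 - ∑ a, prob π a x * prob π₀ a x ^ (1 - α) =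
      ∑ a, (prob π a x - prob π a x * prob π₀ a x ^ (1 - α)) := by
    rw [Finset.sum_sub_distrib, sum_prob]
  rw [integral_policy_eq_sum, hB, ← Finset.sum_sub_distrib]
  refine (Finset.abs_sum_le_sum_abs _ _).trans (Finset.sum_le_sum fun b _ => ?_)
  have hc := meanCost_mem_Icc hp x b
  have hq := prob_nonneg π b x
  have hw := prob_nonneg π₀ b x
  have hw1 : prob π₀ b x ≤ 1 := measureReal_le_one
  have h1 : prob π b x * (prob π₀ b x / prob π₀ b x ^ α * meanCost p x b) =
      prob π b x * (prob π₀ b x ^ (1 - α) * meanCost p x b) := by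
    rcases hw.eq_or_lt with h0 | h0
    · rcases hα.eq_or_lt with h | h
      -- Here `0 ^ (1 - α) = 1` while `0 / 0 ^ α = 0`; overlap makes the prefactor vanish.
      · simp [hover h b h0.symm]
      · simp [← h0, Real.zero_rpow (sub_pos.2 h).ne']
    · rw [Real.rpow_sub h0, Real.rpow_one]
  have h2 : prob π₀ b x ^ (1 - α) ≤ 1 := Real.rpow_le_one hw hw1 (by linarith)
  have e : prob π b x * meanCost p x b - prob π b x * (prob π₀ b x ^ (1 - α) * meanCost p x b) =
      (prob π b x - prob π b x * prob π₀ b x ^ (1 - α)) * meanCost p x b := by ring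
  have h3 : 0 ≤ prob π b x - prob π b x * prob π₀ b x ^ (1 - α) :=
    sub_nonneg.2 (mul_le_of_le_one_right hq h2)
  rw [h1, e, abs_mul, abs_of_nonneg h3]
  exact mul_le_of_le_one_right h3 (abs_le.2 ⟨hc.1, hc.2.trans zero_le_one⟩)

theorem abs_average_smoothing_bias_le {π₀ π : Kernel X (Fin K)} [IsMarkovKernel π₀]
    [IsMarkovKernel π] {p : Kernel (X × Fin K) ℝ} [IsMarkovKernel p]
    (hp : ∀ x a, ∀ᵐ c ∂(p (x, a)), c ∈ Set.Icc (-1 : ℝ) 0) {α : ℝ} (hα : α ≤ 1)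
    (hover : α = 1 → ∀ x a, prob π₀ a x = 0 → prob π a x = 0) {n : ℕ} (hn : 1 ≤ n)
    (D : Fin n → X × Fin K × ℝ) :
    |1 / (n : ℝ) * ∑ i, ∑ b, prob π b (D i).1 * meanCost p (D i).1 b -
        1 / (n : ℝ) * ∑ i, ∑ b, prob π b (D i).1 *
          (prob π₀ b (D i).1 / prob π₀ b (D i).1 ^ α * meanCost p (D i).1 b)| ≤
      empiricalBias π₀ α D π := by
  have hn0 : (n : ℝ) ≠ 0 := by positivity
  have e : empiricalBias π₀ α D π =
      1 / (n : ℝ) * ∑ i, (1 - ∫ a, prob π₀ a (D i).1 ^ (1 - α) ∂(π (D i).1)) := by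
    rw [empiricalBias, Finset.sum_sub_distrib]
    simp only [Finset.sum_const, Finset.card_univ, Fintype.card_fin, nsmul_eq_mul]
    field_simp
  rw [e, ← mul_sub, ← Finset.sum_sub_distrib, abs_mul, abs_of_nonneg (by positivity)]
  exact mul_le_mul_of_nonneg_left ((Finset.abs_sum_le_sum_abs _ _).trans
    (Finset.sum_le_sum fun i _ => abs_smoothing_bias_le hp hα _ fun h a => hover h _ a))
    (by positivity)

theorem sum_sum_prob_mul_score {π₀ : Kernel X (Fin K)} [IsMarkovKernel π₀]
    (p : Kernel (X × Fin K) ℝ) (α θ : ℝ) {n : ℕ} (hn : 1 ≤ n) (D : Fin n → X × Fin K × ℝ)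
    (π : Kernel X (Fin K)) :
    ∑ i, ∑ b, prob π b (D i).1 * score π₀ p α θ (D i) b =
      n * (θ * (estimator π₀ α D π - 1 / (n : ℝ) * ∑ i, ∑ b, prob π b (D i).1 *
        (prob π₀ b (D i).1 / prob π₀ b (D i).1 ^ α * meanCost p (D i).1 b)) -
        θ ^ 2 / 2 * secondMoment π₀ α D π) := by
  have hn0 : (n : ℝ) ≠ 0 := by positivity
  simp only [fun i => sum_prob_mul_score (π₀ := π₀) p α θ (D i) fun b => prob π b (D i).1]
  rw [estimator, secondMoment, Finset.sum_sub_distrib, ← Finset.mul_sum, ← Finset.mul_sum,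
    Finset.sum_sub_distrib]
  field_simp

end OffPolicy

theorem theorem1 {X H : Type*} [MeasurableSpace X] [MeasurableSpace H] {K : ℕ}
    (ν : Measure X) [IsProbabilityMeasure ν]
    (π₀ : Kernel X (Fin K)) [IsMarkovKernel π₀]
    (p : Kernel (X × Fin K) ℝ) [IsMarkovKernel p]
    (hp : ∀ x a, ∀ᵐ c ∂(p (x, a)), c ∈ Set.Icc (-1 : ℝ) 0)
    (pred : H → X → Fin K) (hpred : Measurable (Function.uncurry pred))
    (P : Measure H) [IsProbabilityMeasure P]
    (lam : ℝ) (hlam : 0 < lam) (n : ℕ) (hn : 1 ≤ n)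
    (δ : ℝ) (hδ : δ ∈ Set.Ioo (0 : ℝ) 1) (α : ℝ) (hα : α ∈ Set.Icc (0 : ℝ) 1) :
    ∃ E : Set (Fin n → X × Fin K × ℝ), MeasurableSet E ∧
      ENNReal.ofReal (1 - δ) ≤ Measure.pi (fun _ : Fin n => OffPolicy.jointLaw ν π₀ p) E ∧
      ∀ D ∈ E, ∀ (Q : Measure H) [IsProbabilityMeasure Q],
        InformationTheory.klDiv Q P ≠ ⊤ →
        -- overlap, needed only for standard inverse propensity scoring
        (α = 1 → ∀ x a, OffPolicy.prob π₀ a x = 0 →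
          OffPolicy.prob (OffPolicy.inducedPolicy pred hpred Q) a x = 0) →
        |OffPolicy.risk ν p (OffPolicy.inducedPolicy pred hpred Q) -
            OffPolicy.estimator π₀ α D (OffPolicy.inducedPolicy pred hpred Q)| ≤
          Real.sqrt (OffPolicy.kl₁ n δ P Q / (2 * n)) +
            OffPolicy.empiricalBias π₀ α D (OffPolicy.inducedPolicy pred hpred Q) +
            OffPolicy.kl₂ δ P Q / (n * lam) +
            lam / 2 * OffPolicy.secondMoment π₀ α D (OffPolicy.inducedPolicy pred hpred Q) := by
  have hδ0 : 0 < δ := hδ.1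
  have hn0 : (0 : ℝ) < n := by exact_mod_cast hn
  obtain ⟨E₁, hE₁, hP₁, h₁⟩ := OffPolicy.exists_risk_event ν π₀ hp hpred P hn (half_pos hδ0)
  have hδ4 : 0 < δ / 4 := by positivity
  obtain ⟨E₂, hE₂, hP₂, h₂⟩ := OffPolicy.exists_score_event ν π₀ hp hpred P n α lam hδ4
  obtain ⟨E₃, hE₃, hP₃, h₃⟩ := OffPolicy.exists_score_event ν π₀ hp hpred P n α (-lam) hδ4
  refine ⟨E₁ ∩ (E₂ ∩ E₃), hE₁.inter (hE₂.inter hE₃), ?_, ?_⟩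
  · set M := Measure.pi fun _ : Fin n => OffPolicy.jointLaw ν π₀ p
    have hc : M (E₁ ∩ (E₂ ∩ E₃))ᶜ ≤ ENNReal.ofReal δ := by
      rw [Set.compl_inter, Set.compl_inter]
      calc _ ≤ M E₁ᶜ + (M E₂ᶜ + M E₃ᶜ) :=
            (measure_union_le _ _).trans (add_le_add le_rfl (measure_union_le _ _))
        _ ≤ ENNReal.ofReal (δ / 2) + (ENNReal.ofReal (δ / 4) + ENNReal.ofReal (δ / 4)) :=
            add_le_add hP₁ (add_le_add hP₂ hP₃)
        _ = ENNReal.ofReal δ := by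
            rw [← ENNReal.ofReal_add hδ4.le hδ4.le, ← ENNReal.ofReal_add (by positivity)
              (by positivity)]
            congr 1
            ring
    have hadd := prob_add_prob_compl (μ := M) (hE₁.inter (hE₂.inter hE₃))
    rw [ENNReal.ofReal_sub _ hδ0.le, ENNReal.ofReal_one, tsub_le_iff_right, ← hadd]
    exact add_le_add le_rfl hc
  · rintro D ⟨hD₁, hD₂, hD₃⟩ Q _ hKL hover
    have b₁ := h₁ D hD₁ Q hKL
    have b₂ := h₂ D hD₂ Q hKL
    have b₃ := h₃ D hD₃ Q hKL
    have b₄ := OffPolicy.abs_average_smoothing_bias_le (p := p) hp hα.2 hover hn D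
    rw [OffPolicy.sum_sum_prob_mul_score p α _ hn] at b₂ b₃
    set π := OffPolicy.inducedPolicy pred hpred Q
    set R := OffPolicy.risk ν p π
    set A := 1 / (n : ℝ) * ∑ i, ∑ b, OffPolicy.prob π b (D i).1 * OffPolicy.meanCost p (D i).1 b
    set S := 1 / (n : ℝ) * ∑ i, ∑ b, OffPolicy.prob π b (D i).1 *
      (OffPolicy.prob π₀ b (D i).1 / OffPolicy.prob π₀ b (D i).1 ^ α *
        OffPolicy.meanCost p (D i).1 b)
    set T := OffPolicy.estimator π₀ α D π
    set V := OffPolicy.secondMoment π₀ α D π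
    have hk₁ : (InformationTheory.klDiv Q P).toReal + Real.log (2 * √n / (δ / 2)) =
        OffPolicy.kl₁ n δ P Q := by
      rw [OffPolicy.kl₁]; congr 2; field_simp; ring
    have hk₂ : (InformationTheory.klDiv Q P).toReal + Real.log (1 / (δ / 4)) =
        OffPolicy.kl₂ δ P Q := by
      rw [OffPolicy.kl₂, one_div_div]
    rw [hk₁] at b₁
    rw [hk₂] at b₂ b₃
    have c₁ : |R - A| ≤ √(OffPolicy.kl₁ n δ P Q / (2 * n)) := by
      refine Real.abs_le_sqrt ?_
      rw [le_div_iff₀ (by positivity)]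
      linarith
    have c₂ : |S - T| ≤ OffPolicy.kl₂ δ P Q / (n * lam) + lam / 2 * V := by
      have e : OffPolicy.kl₂ δ P Q / (n * lam) + lam / 2 * V =
          (OffPolicy.kl₂ δ P Q + n * (lam ^ 2 / 2 * V)) / (n * lam) := by
        field_simp
      rw [e, le_div_iff₀ (by positivity), ← abs_of_pos (mul_pos hn0 hlam), ← abs_mul]
      refine abs_le'.2 ⟨?_, ?_⟩ <;> linarith
    calc |R - T| = |(R - A) + (A - S) + (S - T)| := by congr 1; ring
      _ ≤ |R - A| + |A - S| + |S - T| := abs_add_three _ _ _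
      _ ≤ _ := by linarith
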